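/- Let $n\ge 1$ and let $\Omega\subset\mathbb R^n$ be a bounded domain with Lipschitz boundary $\partial\Omega=\Gamma_1\cup\Gamma_2$, where $\Gamma_1,\Gamma_2$ are disjoint and measurable, with positive $(n-1)$-dimensional Hausdorff measure. Write $V=H^1(\Omega)$, $V_0=\{v\in V: v|_{\Gamma_1}=0\}$ (boundary values in the sense of traces). Fix $q_0^*\in L^2(\Gamma_2)$ with $q_0^*>0$ a.e. on $\Gamma_2$, real numbers $\lambda_2\le\lambda_1$, and $g_1,g_2\in L^2(\Omega)$ with $g_1\le g_2$ a.e. in $\Omega$. (a) Let $b\in H^{1/2}(\Gamma_1)$ and, for $i=1,2$, let $u_{\infty b\lambda_i g_i}$ be the variational solution of the mixed problem $P$ with data $b$, $q=\lambda_i q_0^*$, $g=g_i$, where $u$ is the solution of $P$ with data $b,q,g$ if $$u\in V,\quad u|_{\Gamma_1}=b,\qquad \int_\Omega\nabla u\cdot\nabla v\,dx=\int_\Omega g v\,dx-\int_{\Gamma_2}q v\,d\gamma\quad\forall v\in V_0 .$$ Then $u_{\infty b\lambda_1 g_1}\le u_{\infty b\lambda_2 g_2}$ a.e. in $\Omega$.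 (b) Let $\alpha>0$, let $b_1,b_2\in H^{1/2}(\Gamma_1)$ with $b_1\le b_2$ a.e. on $\Gamma_1$ and, for $i=1,2$, let $u_{\infty\alpha b_i\lambda_i g_i}$ be the variational solution of the Robin problem $P_\alpha$ with data $b_i$, $q=\lambda_i q_0^*$, $g=g_i$, where $u$ is the solution of $P_\alpha$ with data $b,q,g$ if $$u\in V,\qquad \int_\Omega\nabla u\cdot\nabla v\,dx+\alpha\int_{\Gamma_1}u v\,d\gamma=\int_\Omega g v\,dx-\int_{\Gamma_2}q v\,d\gamma+\alpha\int_{\Gamma_1}b v\,d\gamma\quad\forall v\in V .$$ Then $u_{\infty\alpha b_1\lambda_1 g_1}\le u_{\infty\alpha b_2\lambda_2 g_2}$ a.e. in $\Omega$. -/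

import Mathlib

open MeasureTheory Set Filter Topology
open scoped ContDiff

/-- The Euclidean space `ℝⁿ`. -/
abbrev Euc (n : ℕ) : Type := EuclideanSpace ℝ (Fin n)

/-- A bounded domain (nonempty, open, connected) of `ℝ^{d+1}` with regular, i.e. Lipschitz, boundary:
near every boundary point, and in suitable orthonormal coordinates `(y', y_{d+1}) ∈ ℝ^d × ℝ`, the
domain is the set of the points that lie strictly above the graph of a Lipschitz function. -/
structure IsBoundedLipschitzDomain {d : ℕ} (Ω : Set (Euc (d + 1))) : Prop where
  isOpen : IsOpen Ω
  isConnected : IsConnected Ω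
  isBounded : Bornology.IsBounded Ω
  lipschitz_boundary : ∀ x₀ ∈ frontier Ω,
    ∃ (e : Euc (d + 1) ≃ₗᵢ[ℝ] WithLp 2 (Euc d × ℝ)) (γ : Euc d → ℝ) (K : NNReal) (r : ℝ),
      LipschitzWith K γ ∧ 0 < r ∧
        Ω ∩ Metric.ball x₀ r = {x | γ (e x).fst < (e x).snd} ∩ Metric.ball x₀ r

/-- Surface measure on a subset `Γ` of `ℝ^{d+1}`: the `d`-dimensional Hausdorff measure, normalised
so that it is Lebesgue measure on `ℝ^d`, restricted to `Γ`. -/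
noncomputable def surf {d : ℕ} (Γ : Set (Euc (d + 1))) : Measure (Euc (d + 1)) :=
  (Measure.euclideanHausdorffMeasure d).restrict Γ

/-- `G` is the weak gradient of `u` on `Ω`: `∫_Ω u ∇φ = - ∫_Ω φ G` for all test functions
`φ ∈ C_c^∞(Ω)`. -/
def IsWeakGradient {n : ℕ} (Ω : Set (Euc n)) (u : Euc n → ℝ) (G : Euc n → Euc n) : Prop :=
  ∀ φ : Euc n → ℝ, ContDiff ℝ ∞ φ → HasCompactSupport φ → tsupport φ ⊆ Ω →
    ∫ x in Ω, u x • gradient φ x = - ∫ x in Ω, φ x • G x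

/-- A function of the Sobolev space `V = H¹(Ω)`, together with its weak gradient. -/
structure H1 {n : ℕ} (Ω : Set (Euc n)) where
  /-- the function -/
  toFun : Euc n → ℝ
  /-- its weak gradient -/
  grad : Euc n → Euc n
  memLp_toFun : MemLp toFun 2 (volume.restrict Ω)
  memLp_grad : MemLp grad 2 (volume.restrict Ω)
  isWeakGradient : IsWeakGradient Ω toFun grad

/-- `f ∈ L²(∂Ω)` is the trace of `u ∈ H¹(Ω)`, the trace operator being the extension by continuity
of the restriction of smooth functions to the boundary: there are smooth `φ_k` with `φ_k → u` in
`H¹(Ω)` and `φ_k|_{∂Ω} → f` in `L²(∂Ω)`. (On a bounded Lipschitz domain every `u ∈ H¹(Ω)` has a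
trace, and it is unique up to equality almost everywhere.) -/
def HasTrace {d : ℕ} {Ω : Set (Euc (d + 1))} (u : H1 Ω) (f : Euc (d + 1) → ℝ) : Prop :=
  MemLp f 2 (surf (frontier Ω)) ∧
    ∃ φ : ℕ → Euc (d + 1) → ℝ, (∀ k, ContDiff ℝ ∞ (φ k)) ∧
      Tendsto (fun k => eLpNorm (φ k - u.toFun) 2 (volume.restrict Ω)) atTop (𝓝 0) ∧
      Tendsto (fun k => eLpNorm (gradient (φ k) - u.grad) 2 (volume.restrict Ω)) atTop (𝓝 0) ∧
      Tendsto (fun k => eLpNorm (φ k - f) 2 (surf (frontier Ω))) atTop (𝓝 0)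

/-- `b ∈ H^{1/2}(Γ₁)`: on `Γ₁`, `b` is the trace of a function of `H¹(Ω)`. -/
def MemHHalf {d : ℕ} (Ω Γ₁ : Set (Euc (d + 1))) (b : Euc (d + 1) → ℝ) : Prop :=
  ∃ (v : H1 Ω) (f : Euc (d + 1) → ℝ), HasTrace v f ∧ f =ᵐ[surf Γ₁] b

/-- The Dirichlet form `a(u, v) = ∫_Ω ∇u · ∇v dx`. -/
noncomputable def dirichletForm {n : ℕ} {Ω : Set (Euc n)} (u v : H1 Ω) : ℝ :=
  ∫ x in Ω, inner ℝ (u.grad x) (v.grad x)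

/-- `u` is a variational solution of the problem `P`:
`-Δu = g` in `Ω`, `u = b` on `Γ₁`, `-∂u/∂n = q` on `Γ₂`. That is, `u ∈ H¹(Ω)`, `u|_{Γ₁} = b`, and
`a(u, v) = ∫_Ω g v dx - ∫_{Γ₂} q v dγ` for all `v ∈ V₀ = {v ∈ H¹(Ω) : v|_{Γ₁} = 0}`. -/
def IsSolutionP {d : ℕ} {Ω : Set (Euc (d + 1))} (Γ₁ Γ₂ : Set (Euc (d + 1)))
    (b q g : Euc (d + 1) → ℝ) (u : H1 Ω) : Prop :=
  (∃ tu : Euc (d + 1) → ℝ, HasTrace u tu ∧ tu =ᵐ[surf Γ₁] b) ∧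
    ∀ (v : H1 Ω) (tv : Euc (d + 1) → ℝ), HasTrace v tv → tv =ᵐ[surf Γ₁] 0 →
      dirichletForm u v = (∫ x in Ω, g x * v.toFun x) - ∫ x, q x * tv x ∂(surf Γ₂)

/-- `u` is a variational solution of the problem `P_α`:
`-Δu = g` in `Ω`, `-∂u/∂n = α (u - b)` on `Γ₁`, `-∂u/∂n = q` on `Γ₂`. That is, `u ∈ H¹(Ω)` and
`a(u, v) + α ∫_{Γ₁} u v dγ = ∫_Ω g v dx - ∫_{Γ₂} q v dγ + α ∫_{Γ₁} b v dγ` for all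
`v ∈ V = H¹(Ω)`. -/
def IsSolutionPα {d : ℕ} {Ω : Set (Euc (d + 1))} (Γ₁ Γ₂ : Set (Euc (d + 1))) (α : ℝ)
    (b q g : Euc (d + 1) → ℝ) (u : H1 Ω) : Prop :=
  ∃ tu : Euc (d + 1) → ℝ, HasTrace u tu ∧
    ∀ (v : H1 Ω) (tv : Euc (d + 1) → ℝ), HasTrace v tv →
      dirichletForm u v + α * ∫ x, tu x * tv x ∂(surf Γ₁) =
        (∫ x in Ω, g x * v.toFun x) - (∫ x, q x * tv x ∂(surf Γ₂)) +
          α * ∫ x, b x * tv x ∂(surf Γ₁)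

/-!
Put `w = u₁ - u₂`, where `u₁`, `u₂` are the two solutions to be compared. The classical proof tests
the difference of the two variational equations with the positive part `w⁺`. Here `w⁺` is replaced by
`z = η(w)`, with `η` the smooth, bounded and nondecreasing function `Real.smoothTransition`, which
vanishes exactly on `(-∞, 0]`. Since `η` is smooth with bounded derivative, approximating `w` by
smooth functions `φ_k` shows that `η(w)` belongs to `H¹(Ω)`, with gradient `η'(w) ∇w` and with trace
`η(tr w)` (`HasTrace.exists_comp`); nothing has to be known about `∇w` on the level sets of `w`.

As `z ≥ 0`, the ordering of the data gives `a(w, z) = ∫ η'(w) |∇w|² ≤ 0` for the problem `P`, and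
`a(w, z) + α ∫_{Γ₁} w η(w) ≤ 0` for the problem `P_α`. All these integrands are nonnegative, so
`∇z = η'(w) ∇w = 0`, and the trace of `z` vanishes on `Γ₁`: for `P` because `u₁` and `u₂` have the
same trace there, for `P_α` because `t η(t) = 0` forces `η(t) = 0`.

It remains to see that a function of `H¹(Ω)` with zero gradient, whose trace vanishes on a boundary
part of positive measure, is zero (`IsBoundedLipschitzDomain.ae_eq_zero_of_grad_eq_zero`). It is
invariant under small translations, hence locally constant, hence equal to a constant `c` on the
connected set `Ω`. That its trace is `c` is a local trace estimate in `L¹`: near a boundary point,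
surface measure on the Lipschitz graph times arc length in the vertical direction is dominated by the
volume (`IsBoundedLipschitzDomain.exists_lintegral_boundary_layer_le`), so that the values of `φ_k`
on the boundary are controlled by the values and the gradient of `φ_k` in `Ω`. Hence `c = 0`, that is
`η(w) = 0`, which means `w ≤ 0`.
-/

/-! ### Convergence in `L²` -/

section Convergence

variable {X E : Type*} [MeasurableSpace X] [NormedAddCommGroup E] {μ : Measure X}

theorem tendsto_eLpNorm_two_of_dominated {F : ℕ → X → E} {B : X → ℝ}
    (hF : ∀ k, AEStronglyMeasurable (F k) μ) (hB : MemLp B 2 μ)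
    (hle : ∀ k, ∀ᵐ x ∂μ, ‖F k x‖ ≤ B x) (hlim : ∀ᵐ x ∂μ, Tendsto (fun k => F k x) atTop (𝓝 0)) :
    Tendsto (fun k => eLpNorm (F k) 2 μ) atTop (𝓝 0) := by
  simp only [eLpNorm_eq_lintegral_rpow_enorm_toReal two_ne_zero ENNReal.ofNat_ne_top,
    ENNReal.toReal_ofNat]
  have h0 : (0 : ENNReal) = (∫⁻ _, 0 ∂μ) ^ (1 / (2 : ℝ)) := by simp
  rw [h0]
  refine ((ENNReal.continuous_rpow_const).tendsto _).comp ?_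
  refine tendsto_lintegral_of_dominated_convergence' (fun x => ‖B x‖ₑ ^ (2 : ℝ))
    (fun k => (hF k).enorm.pow_const _) (fun k => ?_) ?_ ?_
  · filter_upwards [hle k] with x hx
    refine ENNReal.rpow_le_rpow ?_ (by norm_num)
    exact enorm_le_iff_norm_le.2 (hx.trans (le_abs_self _))
  · have := lintegral_rpow_enorm_lt_top_of_eLpNorm_lt_top two_ne_zero ENNReal.ofNat_ne_top hB.2
    simpa using this.ne
  · filter_upwards [hlim] with x hx
    have h := ((ENNReal.continuous_rpow_const (y := (2 : ℝ))).comp continuous_enorm).tendsto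
      (0 : E)
    have h2 := h.comp hx
    simpa using! h2

theorem exists_seq_tendsto_ae_of_tendsto_eLpNorm_two {F : ℕ → X → E} {f : X → E}
    (hF : ∀ k, AEStronglyMeasurable (F k) μ) (hf : AEStronglyMeasurable f μ)
    (h : Tendsto (fun k => eLpNorm (F k - f) 2 μ) atTop (𝓝 0)) :
    ∃ ns : ℕ → ℕ, StrictMono ns ∧
      ∀ᵐ x ∂μ, Tendsto (fun k => F (ns k) x) atTop (𝓝 (f x)) :=
  (tendstoInMeasure_of_tendsto_eLpNorm two_ne_zero hF hf h).exists_seq_tendsto_ae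

theorem tendsto_eLpNorm_two_of_eq_add {F A B : ℕ → X → E}
    (hA : ∀ k, AEStronglyMeasurable (A k) μ) (hB : ∀ k, AEStronglyMeasurable (B k) μ)
    (h : ∀ k, F k = A k + B k) (hAt : Tendsto (fun k => eLpNorm (A k) 2 μ) atTop (𝓝 0))
    (hBt : Tendsto (fun k => eLpNorm (B k) 2 μ) atTop (𝓝 0)) :
    Tendsto (fun k => eLpNorm (F k) 2 μ) atTop (𝓝 0) := by
  have := hAt.add hBt
  rw [add_zero] at this
  refine tendsto_of_tendsto_of_tendsto_of_le_of_le tendsto_const_nhds this (fun _ => zero_le)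
    fun k => ?_
  rw [h k]
  exact eLpNorm_add_le (hA k) (hB k) (by norm_num)

theorem tendsto_eLpNorm_two_sub_sub {A B : ℕ → X → E} {a b : X → E}
    (hA : ∀ k, AEStronglyMeasurable (A k - a) μ) (hB : ∀ k, AEStronglyMeasurable (B k - b) μ)
    (hAt : Tendsto (fun k => eLpNorm (A k - a) 2 μ) atTop (𝓝 0))
    (hBt : Tendsto (fun k => eLpNorm (B k - b) 2 μ) atTop (𝓝 0)) :
    Tendsto (fun k => eLpNorm (A k - B k - (a - b)) 2 μ) atTop (𝓝 0) :=
  tendsto_eLpNorm_two_of_eq_add (B := fun k => -(B k - b)) hA (fun k => (hB k).neg)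
    (fun k => by abel) hAt (by simpa only [eLpNorm_neg] using hBt)

theorem tendsto_eLpNorm_two_of_norm_le_mul {E' : Type*} [NormedAddCommGroup E']
    {F : ℕ → X → E} {A : ℕ → X → E'} {C : ℝ} (h : ∀ k x, ‖F k x‖ ≤ C * ‖A k x‖)
    (hA : Tendsto (fun k => eLpNorm (A k) 2 μ) atTop (𝓝 0)) :
    Tendsto (fun k => eLpNorm (F k) 2 μ) atTop (𝓝 0) := by
  have := ENNReal.Tendsto.const_mul (a := ENNReal.ofReal C) hA (Or.inr ENNReal.ofReal_ne_top)
  rw [mul_zero] at this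
  refine tendsto_of_tendsto_of_tendsto_of_le_of_le tendsto_const_nhds this (fun _ => zero_le)
    fun k => ?_
  exact eLpNorm_le_mul_eLpNorm_of_ae_le_mul (Eventually.of_forall (h k)) 2

theorem tendsto_integral_smul_of_tendsto_eLpNorm_two [NormedSpace ℝ E] {U : ℕ → X → ℝ} {u : X → ℝ}
    {V : ℕ → X → E} {v : X → E}
    (hU : ∀ k, MemLp (U k) 2 μ) (hu : MemLp u 2 μ) (hV : ∀ k, MemLp (V k) 2 μ) (hv : MemLp v 2 μ)
    (hUt : Tendsto (fun k => eLpNorm (U k - u) 2 μ) atTop (𝓝 0))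
    (hVt : Tendsto (fun k => eLpNorm (V k - v) 2 μ) atTop (𝓝 0)) :
    Tendsto (fun k => ∫ x, U k x • V k x ∂μ) atTop (𝓝 (∫ x, u x • v x ∂μ)) := by
  refine tendsto_integral_of_L1' (fun x => u x • v x) (hu.1.smul hv.1)
    (Eventually.of_forall fun k => memLp_one_iff_integrable.1 ((hV k).smul (hU k))) ?_
  have hb : ∀ k, eLpNorm ((fun x => U k x • V k x) - fun x => u x • v x) 1 μ ≤
      eLpNorm (U k - u) 2 μ * (eLpNorm (V k - v) 2 μ + eLpNorm v 2 μ) +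
        eLpNorm u 2 μ * eLpNorm (V k - v) 2 μ := by
    intro k
    have e : ((fun x => U k x • V k x) - fun x => u x • v x) =
        (U k - u) • V k + u • (V k - v) := by
      ext x; simp [sub_smul, smul_sub]
    rw [e]
    refine (eLpNorm_add_le (((hU k).1.sub hu.1).smul (hV k).1) (hu.1.smul ((hV k).1.sub hv.1))
      le_rfl).trans (add_le_add ?_ ?_)
    · refine (eLpNorm_smul_le_mul_eLpNorm (p := 2) (q := 2) (hV k).1 ((hU k).1.sub hu.1)).trans ?_
      gcongr
      conv_lhs => rw [← sub_add_cancel (V k) v]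
      exact eLpNorm_add_le ((hV k).1.sub hv.1) hv.1 (by norm_num)
    · exact eLpNorm_smul_le_mul_eLpNorm (p := 2) (q := 2) ((hV k).1.sub hv.1) hu.1
  refine tendsto_of_tendsto_of_tendsto_of_le_of_le tendsto_const_nhds ?_ (fun _ => zero_le) hb
  have h1 : Tendsto (fun k => eLpNorm (V k - v) 2 μ + eLpNorm v 2 μ) atTop
      (𝓝 (0 + eLpNorm v 2 μ)) := hVt.add tendsto_const_nhds
  have h2 := ENNReal.Tendsto.mul hUt (Or.inr (by simpa using hv.2.ne)) h1 (Or.inr ENNReal.zero_ne_top)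
  have h3 := ENNReal.Tendsto.const_mul (a := eLpNorm u 2 μ) hVt (Or.inr hu.2.ne)
  simpa using h2.add h3

end Convergence

/-! ### Weak gradients -/

section WeakGradient

variable {n : ℕ} {Ω : Set (Euc n)}

theorem gradient_eq_toDual_symm_fderiv (φ : Euc n → ℝ) :
    gradient φ = fun x => (InnerProductSpace.toDual ℝ (Euc n)).symm (fderiv ℝ φ x) := rfl

theorem ContDiff.continuous_gradient {φ : Euc n → ℝ} (hφ : ContDiff ℝ ∞ φ) :
    Continuous (gradient φ) :=
  (InnerProductSpace.toDual ℝ (Euc n)).symm.continuous.comp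
    (hφ.continuous_fderiv (by simp))

theorem HasCompactSupport.gradient {φ : Euc n → ℝ} (hφ : HasCompactSupport φ) :
    HasCompactSupport (gradient φ) :=
  (hφ.fderiv ℝ).comp_left (map_zero _)

theorem gradient_comp_real {η : ℝ → ℝ} {φ : Euc n → ℝ} (hη : Differentiable ℝ η)
    (hφ : Differentiable ℝ φ) (x : Euc n) :
    gradient (η ∘ φ) x = deriv η (φ x) • gradient φ x := by
  simp only [gradient_eq_toDual_symm_fderiv]
  rw [fderiv_comp x (hη _) (hφ x), ← map_smul]
  congr 1
  ext v
  simp [fderiv_eq_smul_deriv, mul_comm]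

theorem gradient_sub_eq {φ ψ : Euc n → ℝ} (hφ : Differentiable ℝ φ)
    (hψ : Differentiable ℝ ψ) : gradient (φ - ψ) = gradient φ - gradient ψ := by
  ext1 x
  simp only [gradient_eq_toDual_symm_fderiv, Pi.sub_apply]
  rw [fderiv_sub (hφ x) (hψ x), map_sub]

theorem Continuous.memLp_restrict_of_isBounded {E : Type*} [NormedAddCommGroup E]
    {f : Euc n → E} (hf : Continuous f) (hΩ : Bornology.IsBounded Ω) :
    MemLp f 2 (volume.restrict Ω) := by
  have : IsFiniteMeasure (volume.restrict Ω) :=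
    ⟨by simpa using hΩ.measure_lt_top⟩
  obtain ⟨C, hC⟩ := hΩ.isCompact_closure.exists_bound_of_continuousOn hf.continuousOn
  refine MemLp.of_bound hf.aestronglyMeasurable C ?_
  refine ae_restrict_of_ae_restrict_of_subset subset_closure ?_
  filter_upwards [ae_restrict_mem isClosed_closure.measurableSet] with x hx using hC x hx

theorem ContDiff.memLp_gradient {φ : Euc n → ℝ} (hφ : ContDiff ℝ ∞ φ) (hc : HasCompactSupport φ) :
    MemLp (gradient φ) 2 (volume.restrict Ω) :=
  (hφ.continuous_gradient.memLp_of_hasCompactSupport hc.gradient).restrict Ω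

/-- The gradient of a smooth function is its weak gradient, by integration by parts against
compactly supported test functions. -/
theorem isWeakGradient_gradient {F : Euc n → ℝ} (hF : ContDiff ℝ ∞ F) :
    IsWeakGradient Ω F (gradient F) := by
  intro φ hφ hc hs
  have hz : ∀ x, x ∉ Ω → φ x = 0 := fun x hx => image_eq_zero_of_notMem_tsupport fun h => hx (hs h)
  have hz' : ∀ x, x ∉ Ω → gradient φ x = 0 := fun x hx => by
    have : fderiv ℝ φ x = 0 :=
      image_eq_zero_of_notMem_tsupport fun h => hx (hs (tsupport_fderiv_subset ℝ h))
    simp [gradient_eq_toDual_symm_fderiv, this]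
  rw [setIntegral_eq_integral_of_forall_compl_eq_zero fun x hx => by simp [hz' x hx],
    setIntegral_eq_integral_of_forall_compl_eq_zero fun x hx => by simp [hz x hx]]
  have hi1 : Integrable fun x => F x • gradient φ x :=
    (hF.continuous.smul hφ.continuous_gradient).integrable_of_hasCompactSupport hc.gradient.smul_left
  have hi2 : Integrable fun x => φ x • gradient F x :=
    (hφ.continuous.smul hF.continuous_gradient).integrable_of_hasCompactSupport hc.smul_right
  refine ext_inner_left ℝ fun v => ?_
  rw [inner_neg_right, ← integral_inner hi1, ← integral_inner hi2]
  have key := integral_mul_fderiv_eq_neg_fderiv_mul_of_integrable (μ := volume) (f := F) (g := φ)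
    (v := v) ?_ ?_ ?_ (fun x _ => hF.differentiable (by simp) x)
    (fun x _ => hφ.differentiable (by simp) x)
  · simp only [inner_smul_right, inner_gradient_right, conj_trivial]
    rw [key]
    simp only [mul_comm]
  · exact (((hF.continuous_fderiv (by simp)).clm_apply continuous_const).mul
      hφ.continuous).integrable_of_hasCompactSupport hc.mul_left
  · refine (hF.continuous.mul ((hφ.continuous_fderiv (by simp)).clm_apply
      continuous_const)).integrable_of_hasCompactSupport (HasCompactSupport.mul_left ?_)
    exact (hc.fderiv ℝ).comp_left (g := fun L : Euc n →L[ℝ] ℝ => L v) rfl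
  · exact (hF.continuous.mul hφ.continuous).integrable_of_hasCompactSupport hc.mul_left

/-- The graph of the weak gradient is closed in `L²(Ω) × L²(Ω)ⁿ`. -/
theorem isWeakGradient_of_tendsto {U : ℕ → Euc n → ℝ} {V : ℕ → Euc n → Euc n} {u : Euc n → ℝ}
    {G : Euc n → Euc n} (hU : ∀ k, MemLp (U k) 2 (volume.restrict Ω))
    (hV : ∀ k, MemLp (V k) 2 (volume.restrict Ω)) (hu : MemLp u 2 (volume.restrict Ω))
    (hG : MemLp G 2 (volume.restrict Ω)) (hw : ∀ k, IsWeakGradient Ω (U k) (V k))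
    (hUt : Tendsto (fun k => eLpNorm (U k - u) 2 (volume.restrict Ω)) atTop (𝓝 0))
    (hVt : Tendsto (fun k => eLpNorm (V k - G) 2 (volume.restrict Ω)) atTop (𝓝 0)) :
    IsWeakGradient Ω u G := by
  intro φ hφ hc hs
  have hφ2 : MemLp φ 2 (volume.restrict Ω) :=
    (hφ.continuous.memLp_of_hasCompactSupport hc).restrict Ω
  have hg2 : MemLp (gradient φ) 2 (volume.restrict Ω) := hφ.memLp_gradient hc
  have h1 := tendsto_integral_smul_of_tendsto_eLpNorm_two (V := fun _ => gradient φ) hU hu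
    (fun _ => hg2) hg2 hUt (by simp)
  have h2 := tendsto_integral_smul_of_tendsto_eLpNorm_two (U := fun _ => φ) (fun _ => hφ2) hφ2
    hV hG (by simp) hVt
  refine tendsto_nhds_unique h1 ?_
  simp only [fun k => hw k φ hφ hc hs]
  exact h2.neg

/-- The difference of two functions of `H¹(Ω)`. -/
def H1.sub (u v : H1 Ω) : H1 Ω where
  toFun := u.toFun - v.toFun
  grad := u.grad - v.grad
  memLp_toFun := u.memLp_toFun.sub v.memLp_toFun
  memLp_grad := u.memLp_grad.sub v.memLp_grad
  isWeakGradient := by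
    intro φ hφ hc hs
    have hφ2 : MemLp φ 2 (volume.restrict Ω) :=
      (hφ.continuous.memLp_of_hasCompactSupport hc).restrict Ω
    have hg2 : MemLp (gradient φ) 2 (volume.restrict Ω) := hφ.memLp_gradient hc
    have i1 : ∀ w : H1 Ω, Integrable (fun x => w.toFun x • gradient φ x) (volume.restrict Ω) :=
      fun w => memLp_one_iff_integrable.1 (hg2.smul w.memLp_toFun)
    have i2 : ∀ w : H1 Ω, Integrable (fun x => φ x • w.grad x) (volume.restrict Ω) :=
      fun w => memLp_one_iff_integrable.1 (w.memLp_grad.smul hφ2)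
    simp only [Pi.sub_apply, sub_smul, smul_sub]
    rw [integral_sub (i1 u) (i1 v), integral_sub (i2 u) (i2 v), u.isWeakGradient φ hφ hc hs,
      v.isWeakGradient φ hφ hc hs]
    abel

end WeakGradient

/-! ### Traces -/

section Trace

variable {d : ℕ} {Ω : Set (Euc (d + 1))}

theorem HasTrace.sub {u v : H1 Ω} {f g : Euc (d + 1) → ℝ} (hu : HasTrace u f) (hv : HasTrace v g) :
    HasTrace (u.sub v) (f - g) := by
  obtain ⟨hf, φ, hφ, h1, h2, h3⟩ := hu
  obtain ⟨hg, ψ, hψ, k1, k2, k3⟩ := hv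
  refine ⟨hf.sub hg, fun k => φ k - ψ k, fun k => (hφ k).sub (hψ k), ?_, ?_, ?_⟩
  · exact tendsto_eLpNorm_two_sub_sub
      (fun k => (hφ k).continuous.aestronglyMeasurable.sub u.memLp_toFun.1)
      (fun k => (hψ k).continuous.aestronglyMeasurable.sub v.memLp_toFun.1) h1 k1
  · have : ∀ k, gradient (φ k - ψ k) = gradient (φ k) - gradient (ψ k) := fun k =>
      gradient_sub_eq ((hφ k).differentiable (by simp)) ((hψ k).differentiable (by simp))
    simp only [this]
    exact tendsto_eLpNorm_two_sub_sub
      (fun k => (hφ k).continuous_gradient.aestronglyMeasurable.sub u.memLp_grad.1)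
      (fun k => (hψ k).continuous_gradient.aestronglyMeasurable.sub v.memLp_grad.1) h2 k2
  · exact tendsto_eLpNorm_two_sub_sub
      (fun k => (hφ k).continuous.aestronglyMeasurable.sub hf.1)
      (fun k => (hψ k).continuous.aestronglyMeasurable.sub hg.1) h3 k3

/-- Chain rule in `H¹(Ω)`: the superposition of a function `w` that has a trace `f` with a smooth
function `η` that vanishes at `0` and has a bounded derivative is again in `H¹(Ω)`, and its trace is
`η ∘ f`. -/
theorem HasTrace.exists_comp (hΩ : Bornology.IsBounded Ω) {w : H1 Ω} {f : Euc (d + 1) → ℝ}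
    (hw : HasTrace w f) {η : ℝ → ℝ} (hη : ContDiff ℝ ∞ η) (hη0 : η 0 = 0) {C : ℝ}
    (hC : ∀ t, |deriv η t| ≤ C) :
    ∃ z : H1 Ω, z.toFun = η ∘ w.toFun ∧ (z.grad = fun x => deriv η (w.toFun x) • w.grad x) ∧
      HasTrace z (η ∘ f) := by
  obtain ⟨hf, φ₀, hφ₀, h1₀, h2₀, h3₀⟩ := hw
  -- Along a subsequence the approximants converge almost everywhere, so that `η'(φ_k) → η'(w)`.
  obtain ⟨ns, hns, hae⟩ := exists_seq_tendsto_ae_of_tendsto_eLpNorm_two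
    (fun k => (hφ₀ k).continuous.aestronglyMeasurable) w.memLp_toFun.1 h1₀
  set φ : ℕ → Euc (d + 1) → ℝ := fun k => φ₀ (ns k) with hφdef
  have hφ : ∀ k, ContDiff ℝ ∞ (φ k) := fun k => hφ₀ _
  have h1 := h1₀.comp hns.tendsto_atTop
  have h2 := h2₀.comp hns.tendsto_atTop
  have h3 := h3₀.comp hns.tendsto_atTop
  have hdη : Differentiable ℝ η := hη.differentiable (by simp)
  have hcd : Continuous (deriv η) := hη.continuous_deriv (by simp)
  have hlip : ∀ s t, ‖η s - η t‖ ≤ C * ‖s - t‖ := fun s t =>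
    Convex.norm_image_sub_le_of_norm_deriv_le (s := univ) (fun x _ => hdη x) (fun x _ => hC x)
      convex_univ (mem_univ _) (mem_univ _)
  have hmem : ∀ {μ : Measure (Euc (d + 1))} {a : Euc (d + 1) → ℝ}, MemLp a 2 μ →
      MemLp (η ∘ a) 2 μ := fun {μ a} ha =>
    MemLp.of_le_mul (c := C) ha (hη.continuous.comp_aestronglyMeasurable ha.1)
      (Eventually.of_forall fun x => by simpa [hη0] using hlip (a x) 0)
  have hG : MemLp (fun x => deriv η (w.toFun x) • w.grad x) 2 (volume.restrict Ω) :=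
    MemLp.of_le_mul (c := C) w.memLp_grad
      ((hcd.comp_aestronglyMeasurable w.memLp_toFun.1).smul w.memLp_grad.1)
      (Eventually.of_forall fun x => by
        rw [norm_smul]; exact mul_le_mul_of_nonneg_right (hC _) (norm_nonneg _))
  have hsm : ∀ k, ContDiff ℝ ∞ (η ∘ φ k) := fun k => hη.comp (hφ k)
  have t1 : Tendsto (fun k => eLpNorm (η ∘ φ k - η ∘ w.toFun) 2 (volume.restrict Ω)) atTop
      (𝓝 0) :=
    tendsto_eLpNorm_two_of_norm_le_mul (fun k x => hlip (φ k x) (w.toFun x)) h1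
  have t3 : Tendsto (fun k => eLpNorm (η ∘ φ k - η ∘ f) 2 (surf (frontier Ω))) atTop (𝓝 0) :=
    tendsto_eLpNorm_two_of_norm_le_mul (fun k x => hlip (φ k x) (f x)) h3
  have t2 : Tendsto (fun k => eLpNorm (gradient (η ∘ φ k) -
      fun x => deriv η (w.toFun x) • w.grad x) 2 (volume.restrict Ω)) atTop (𝓝 0) := by
    -- `η'(φ_k) ∇φ_k - η'(w) ∇w = η'(φ_k) (∇φ_k - ∇w) + (η'(φ_k) - η'(w)) ∇w`: the first term is
    -- bounded by `C |∇φ_k - ∇w|`, the second one is dominated by `2 C |∇w|`.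
    refine tendsto_eLpNorm_two_of_eq_add
      (A := fun k x => deriv η (φ k x) • (gradient (φ k) - w.grad) x)
      (B := fun k x => (deriv η (φ k x) - deriv η (w.toFun x)) • w.grad x) ?_ ?_ ?_ ?_ ?_
    · exact fun k => (hcd.comp (hφ k).continuous).aestronglyMeasurable.smul
        ((hφ k).continuous_gradient.aestronglyMeasurable.sub w.memLp_grad.1)
    · exact fun k => ((hcd.comp (hφ k).continuous).aestronglyMeasurable.sub
        (hcd.comp_aestronglyMeasurable w.memLp_toFun.1)).smul w.memLp_grad.1
    · intro k
      ext1 x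
      simp only [Pi.sub_apply, Pi.add_apply,
        gradient_comp_real hdη ((hφ k).differentiable (by simp)), smul_sub, sub_smul]
      abel
    · refine tendsto_eLpNorm_two_of_norm_le_mul (C := C) (fun k x => ?_) h2
      rw [norm_smul]
      exact mul_le_mul_of_nonneg_right (hC _) (norm_nonneg _)
    · refine tendsto_eLpNorm_two_of_dominated (B := fun x => (C + C) * ‖w.grad x‖) ?_
        (w.memLp_grad.norm.const_mul _) ?_ ?_
      · exact fun k => ((hcd.comp (hφ k).continuous).aestronglyMeasurable.sub
          (hcd.comp_aestronglyMeasurable w.memLp_toFun.1)).smul w.memLp_grad.1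
      · refine fun k => Eventually.of_forall fun x => ?_
        rw [norm_smul]
        exact mul_le_mul_of_nonneg_right ((norm_sub_le _ _).trans (add_le_add (hC _) (hC _)))
          (norm_nonneg _)
      · filter_upwards [hae] with x hx
        have := (((hcd.tendsto _).comp hx).sub_const (deriv η (w.toFun x))).smul_const (w.grad x)
        simpa using! this
  refine ⟨⟨η ∘ w.toFun, fun x => deriv η (w.toFun x) • w.grad x, hmem w.memLp_toFun, hG, ?_⟩, rfl,
    rfl, hmem hf, fun k => η ∘ φ k, hsm, t1, t2, t3⟩
  exact isWeakGradient_of_tendsto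
    (fun k => (hsm k).continuous.memLp_restrict_of_isBounded hΩ)
    (fun k => (hsm k).continuous_gradient.memLp_restrict_of_isBounded hΩ)
    (hmem w.memLp_toFun) hG (fun k => isWeakGradient_gradient (hsm k)) t1 t2

end Trace

/-! ### Functions with vanishing gradient -/

section ConstantFunctions

variable {n : ℕ} {Ω : Set (Euc n)}

/-- The fundamental theorem of calculus on the segment from `x` to `x + s • h`, as an estimate. -/
theorem enorm_sub_le_lintegral_gradient {φ : Euc n → ℝ} (hφ : ContDiff ℝ ∞ φ) (x h : Euc n) {s : ℝ}
    (hs : 0 ≤ s) :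
    ‖φ (x + s • h) - φ x‖ₑ ≤ ‖h‖ₑ * ∫⁻ t in Icc 0 s, ‖gradient φ (x + t • h)‖ₑ := by
  have hl : ∀ t : ℝ, HasDerivAt (fun t : ℝ => x + t • h) h t := fun t => by
    simpa using ((hasDerivAt_id t).smul_const h).const_add x
  have hd : ∀ t : ℝ, deriv (fun t : ℝ => φ (x + t • h)) t = inner ℝ (gradient φ (x + t • h)) h :=
    fun t => by
      rw [inner_gradient_left]
      exact ((hφ.differentiable (by simp) _).hasFDerivAt.comp_hasDerivAt t (hl t)).deriv
  have hc : ContDiff ℝ 1 (fun t : ℝ => φ (x + t • h)) :=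
    (hφ.of_le (by simp)).comp (contDiff_const.add (contDiff_id.smul contDiff_const))
  have := enorm_sub_le_lintegral_deriv_of_contDiffOn_Icc (a := 0) (b := s) hc.contDiffOn hs
  simp only [zero_smul, add_zero] at this
  refine this.trans ?_
  rw [← lintegral_const_mul' _ _ enorm_ne_top]
  refine lintegral_mono fun t => ?_
  rw [hd, mul_comm, ← enorm_norm h, ← enorm_norm (gradient φ _), ← enorm_mul]
  refine enorm_le_iff_norm_le.2 ?_
  simpa using abs_real_inner_le_norm (gradient φ (x + t • h)) h

theorem lintegral_translate_le {B : Set (Euc n)} (hB : MeasurableSet B) (hΩ : MeasurableSet Ω)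
    (F : Euc n → ENNReal) {h : Euc n} (hsub : ∀ x ∈ B, x + h ∈ Ω) :
    ∫⁻ x in B, F (x + h) ≤ ∫⁻ x in Ω, F x := by
  rw [← lintegral_indicator hB, ← lintegral_indicator hΩ,
    ← lintegral_add_right_eq_self (Ω.indicator F) h]
  refine lintegral_mono fun x => ?_
  by_cases hx : x ∈ B
  · simp [hx, hsub x hx]
  · simp [hx]

/-- An `L¹`-limit of smooth functions whose gradients tend to `0` in `L¹(Ω)` is invariant under the
translations that keep a ball inside a larger ball contained in `Ω`. -/
theorem ae_translate_eq_of_tendsto_gradient {u : Euc n → ℝ} (hu : Measurable u)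
    {φ : ℕ → Euc n → ℝ} (hφ : ∀ k, ContDiff ℝ ∞ (φ k))
    (ha : Tendsto (fun k => ∫⁻ x in Ω, ‖φ k x - u x‖ₑ) atTop (𝓝 0))
    (hb : Tendsto (fun k => ∫⁻ x in Ω, ‖gradient (φ k) x‖ₑ) atTop (𝓝 0))
    (hΩ : MeasurableSet Ω) {x₀ : Euc n} {r : ℝ} (hball : Metric.ball x₀ (3 * r) ⊆ Ω)
    {h : Euc n} (hh : ‖h‖ < 2 * r) :
    ∀ᵐ x ∂(volume.restrict (Metric.ball x₀ r)), u (x + h) = u x := by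
  set B := Metric.ball x₀ r
  have hB : MeasurableSet B := measurableSet_ball
  have hsub : ∀ t ∈ Icc (0 : ℝ) 1, ∀ x ∈ B, x + t • h ∈ Ω := by
    intro t ht x hx
    apply hball
    have hx' : ‖x - x₀‖ < r := by simpa [B, dist_eq_norm] using hx
    have : ‖t • h‖ ≤ ‖h‖ := by
      rw [norm_smul, Real.norm_of_nonneg ht.1]
      exact mul_le_of_le_one_left (norm_nonneg _) ht.2
    rw [Metric.mem_ball, dist_eq_norm, show x + t • h - x₀ = (x - x₀) + t • h by abel]
    linarith [norm_add_le (x - x₀) (t • h)]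
  have hsub0 : B ⊆ Ω := fun x hx => by simpa using hsub 0 (by simp) x hx
  have hsub1 : ∀ x ∈ B, x + h ∈ Ω := fun x hx => by simpa using hsub 1 (by simp) x hx
  have hmid : ∀ k, ∫⁻ x in B, ‖φ k (x + h) - φ k x‖ₑ ≤
      ‖h‖ₑ * ∫⁻ x in Ω, ‖gradient (φ k) x‖ₑ := by
    intro k
    have hm : Measurable fun p : Euc n × ℝ => ‖gradient (φ k) (p.1 + p.2 • h)‖ₑ :=
      ((hφ k).continuous_gradient.comp (by fun_prop)).measurable.enorm
    calc ∫⁻ x in B, ‖φ k (x + h) - φ k x‖ₑ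
        ≤ ∫⁻ x in B, ‖h‖ₑ * ∫⁻ t in Icc (0 : ℝ) 1, ‖gradient (φ k) (x + t • h)‖ₑ :=
          lintegral_mono fun x => by
            simpa using enorm_sub_le_lintegral_gradient (hφ k) x h zero_le_one
      _ = ‖h‖ₑ * ∫⁻ x in B, ∫⁻ t in Icc (0 : ℝ) 1, ‖gradient (φ k) (x + t • h)‖ₑ :=
          lintegral_const_mul' _ _ enorm_ne_top
      _ = ‖h‖ₑ * ∫⁻ t in Icc (0 : ℝ) 1, ∫⁻ x in B, ‖gradient (φ k) (x + t • h)‖ₑ := by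
          rw [lintegral_lintegral_swap hm.aemeasurable]
      _ ≤ ‖h‖ₑ * ∫⁻ _ in Icc (0 : ℝ) 1, ∫⁻ x in Ω, ‖gradient (φ k) x‖ₑ := by
          gcongr ‖h‖ₑ * ?_
          refine setLIntegral_mono measurable_const fun t ht => ?_
          exact lintegral_translate_le hB hΩ (fun x => ‖gradient (φ k) x‖ₑ) (hsub t ht)
      _ = _ := by simp
  have hle : ∀ k, ∫⁻ x in B, ‖u (x + h) - u x‖ₑ ≤ (∫⁻ x in Ω, ‖φ k x - u x‖ₑ) +
      ((‖h‖ₑ * ∫⁻ x in Ω, ‖gradient (φ k) x‖ₑ) + ∫⁻ x in Ω, ‖φ k x - u x‖ₑ) := by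
    intro k
    have m2 : Measurable fun x => ‖φ k x - u x‖ₑ := ((hφ k).continuous.measurable.sub hu).enorm
    have m1 : Measurable fun x => ‖φ k (x + h) - u (x + h)‖ₑ :=
      m2.comp (measurable_id.add_const h)
    calc ∫⁻ x in B, ‖u (x + h) - u x‖ₑ
        ≤ ∫⁻ x in B, (‖φ k (x + h) - u (x + h)‖ₑ +
            (‖φ k (x + h) - φ k x‖ₑ + ‖φ k x - u x‖ₑ)) := by
          refine lintegral_mono fun x => ?_
          rw [show u (x + h) - u x = -(φ k (x + h) - u (x + h)) +
            ((φ k (x + h) - φ k x) + (φ k x - u x)) by ring]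
          refine (enorm_add_le _ _).trans ?_
          rw [enorm_neg]
          gcongr
          exact enorm_add_le _ _
      _ = (∫⁻ x in B, ‖φ k (x + h) - u (x + h)‖ₑ) +
            ((∫⁻ x in B, ‖φ k (x + h) - φ k x‖ₑ) + ∫⁻ x in B, ‖φ k x - u x‖ₑ) := by
          rw [lintegral_add_left m1, lintegral_add_right _ m2]
      _ ≤ _ := add_le_add (lintegral_translate_le hB hΩ (fun x => ‖φ k x - u x‖ₑ) hsub1)
          (add_le_add (hmid k) (lintegral_mono_set hsub0))
  have hlim := ha.add ((ENNReal.Tendsto.const_mul (a := ‖h‖ₑ) hb (Or.inr enorm_ne_top)).add ha)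
  simp only [mul_zero, add_zero] at hlim
  have h0 : ∫⁻ x in B, ‖u (x + h) - u x‖ₑ = 0 :=
    le_antisymm (ge_of_tendsto' hlim hle) zero_le
  have hm : Measurable fun x => ‖u (x + h) - u x‖ₑ :=
    ((hu.comp (measurable_id.add_const h)).sub hu).enorm
  rw [lintegral_eq_zero_iff hm] at h0
  filter_upwards [h0] with x hx
  simpa [sub_eq_zero] using hx

/-- By Fubini, some point `x` of the ball satisfies `u (x + h) = u x` for almost every small `h`; so
`u` is almost everywhere equal to the value `u x`. -/
theorem exists_ae_eq_const_ball_of_tendsto_gradient {u : Euc n → ℝ} (hu : Measurable u)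
    {φ : ℕ → Euc n → ℝ} (hφ : ∀ k, ContDiff ℝ ∞ (φ k))
    (ha : Tendsto (fun k => ∫⁻ x in Ω, ‖φ k x - u x‖ₑ) atTop (𝓝 0))
    (hb : Tendsto (fun k => ∫⁻ x in Ω, ‖gradient (φ k) x‖ₑ) atTop (𝓝 0))
    (hΩ : MeasurableSet Ω) {x₀ : Euc n} {r : ℝ} (hr : 0 < r)
    (hball : Metric.ball x₀ (3 * r) ⊆ Ω) :
    ∃ c, ∀ᵐ x ∂(volume.restrict (Metric.ball x₀ r)), u x = c := by
  have h1 : ∀ᵐ h ∂(volume.restrict (Metric.ball (0 : Euc n) (2 * r))),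
      ∀ᵐ x ∂(volume.restrict (Metric.ball x₀ r)), u (x + h) = u x := by
    filter_upwards [ae_restrict_mem measurableSet_ball] with h hh
    exact ae_translate_eq_of_tendsto_gradient hu hφ ha hb hΩ hball (by simpa using hh)
  have hm : MeasurableSet {p : Euc n × Euc n | u (p.2 + p.1) = u p.2} :=
    measurableSet_eq_fun (hu.comp (measurable_snd.add measurable_fst)) (hu.comp measurable_snd)
  rw [Measure.ae_ae_comm (p := fun h x => u (x + h) = u x) hm] at h1
  have hne : (ae (volume.restrict (Metric.ball x₀ r))).NeBot := by
    rw [ae_neBot, Ne, Measure.restrict_eq_zero]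
    exact (Metric.measure_ball_pos _ _ hr).ne'
  obtain ⟨x, hx, hxB⟩ := (h1.and (ae_restrict_mem measurableSet_ball)).exists
  refine ⟨u x, ?_⟩
  rw [ae_restrict_iff' measurableSet_ball] at hx ⊢
  have := (measurePreserving_add_left volume (-x)).quasiMeasurePreserving.ae hx
  filter_upwards [this] with y hy hyB
  have := hy ?_
  · simpa using this
  · rw [Metric.mem_ball, dist_eq_norm] at *
    rw [show -x + y - 0 = (y - x₀) - (x - x₀) by abel]
    linarith [norm_sub_le (y - x₀) (x - x₀)]

/-- A function that is locally almost everywhere constant on a connected open set is almost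
everywhere constant there. -/
theorem exists_ae_eq_const_of_locally {u : Euc n → ℝ} (hΩm : MeasurableSet Ω)
    (hΩc : IsConnected Ω)
    (hloc : ∀ x ∈ Ω, ∃ r > 0, ∃ c, ∀ᵐ y ∂(volume.restrict (Metric.ball x r)), u y = c) :
    ∃ c, ∀ᵐ x ∂(volume.restrict Ω), u x = c := by
  obtain ⟨x₀, hx₀⟩ := hΩc.nonempty
  obtain ⟨r₀, hr₀, c₀, hc₀⟩ := hloc x₀ hx₀
  have hopen : ∀ P : ℝ → Prop, IsOpen {x : Euc n | ∃ r > 0, ∃ c, P c ∧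
      ∀ᵐ y ∂(volume.restrict (Metric.ball x r)), u y = c} := by
    intro P
    rw [Metric.isOpen_iff]
    rintro x ⟨r, hr, c, hP, hc⟩
    refine ⟨r / 2, half_pos hr, fun y hy => ⟨r / 2, half_pos hr, c, hP, ?_⟩⟩
    refine ae_restrict_of_ae_restrict_of_subset (Metric.ball_subset_ball' ?_) hc
    rw [Metric.mem_ball] at hy
    linarith
  -- The points near which `u` is `c₀` and those near which it is another constant form two disjoint
  -- open sets.
  have hdis : Disjoint {x : Euc n | ∃ r > 0, ∃ c, c = c₀ ∧
      ∀ᵐ y ∂(volume.restrict (Metric.ball x r)), u y = c} {x : Euc n | ∃ r > 0, ∃ c, c ≠ c₀ ∧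
      ∀ᵐ y ∂(volume.restrict (Metric.ball x r)), u y = c} := by
    rw [Set.disjoint_left]
    rintro x ⟨r, hr, c, rfl, hc⟩ ⟨r', hr', c', hne, hc'⟩
    have hnb : (ae (volume.restrict (Metric.ball x (min r r')))).NeBot := by
      rw [ae_neBot, Ne, Measure.restrict_eq_zero]
      exact (Metric.measure_ball_pos _ _ (lt_min hr hr')).ne'
    obtain ⟨y, h1, h2⟩ := ((ae_restrict_of_ae_restrict_of_subset
      (Metric.ball_subset_ball (min_le_left r r')) hc).and (ae_restrict_of_ae_restrict_of_subset
      (Metric.ball_subset_ball (min_le_right r r')) hc')).exists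
    exact hne (h2.symm.trans h1)
  have hsub := hΩc.isPreconnected.subset_left_of_subset_union (hopen (· = c₀)) (hopen (· ≠ c₀))
    hdis (fun x hx => by
      obtain ⟨r, hr, c, hc⟩ := hloc x hx
      by_cases h : c = c₀
      · exact Or.inl ⟨r, hr, c, h, hc⟩
      · exact Or.inr ⟨r, hr, c, h, hc⟩) ⟨x₀, hx₀, r₀, hr₀, c₀, rfl, hc₀⟩
  refine ⟨c₀, ?_⟩
  rw [ae_restrict_iff' hΩm, ae_iff]
  refine measure_null_of_locally_null _ fun x hx => ?_
  obtain ⟨hxΩ, -⟩ := Classical.not_imp.1 hx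
  obtain ⟨r, hr, c, rfl, hc⟩ := hsub hxΩ
  refine ⟨{y | ¬ u y = c} ∩ Metric.ball x r, ?_, ?_⟩
  · refine mem_of_superset (inter_mem_nhdsWithin _ (Metric.ball_mem_nhds x hr)) fun y hy => ?_
    exact ⟨(Classical.not_imp.1 hy.1).2, hy.2⟩
  · rwa [ae_iff, Measure.restrict_apply' measurableSet_ball] at hc

end ConstantFunctions

/-! ### Lipschitz graphs and boundary values -/

section Boundary

variable {d : ℕ} {Ω : Set (Euc (d + 1))}

theorem LipschitzWith.euclideanHausdorffMeasure_image_le {X Y : Type*} [MetricSpace X]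
    [MetricSpace Y] [MeasurableSpace X] [BorelSpace X] [MeasurableSpace Y] [BorelSpace Y]
    {K : NNReal} {f : X → Y} (hf : LipschitzWith K f) (m : ℕ) (s : Set X) :
    Measure.euclideanHausdorffMeasure m (f '' s) ≤
      (K : ENNReal) ^ m * Measure.euclideanHausdorffMeasure m s := by
  have := hf.hausdorffMeasure_image_le (d := m) (by positivity) s
  rw [ENNReal.rpow_natCast] at this
  simp only [Measure.euclideanHausdorffMeasure_def, Measure.smul_apply, ENNReal.smul_def,
    smul_eq_mul]
  rw [mul_left_comm]
  gcongr

/-- If the open set `Ω` is `{p < q}` in a ball, then its frontier in that ball lies in `{p = q}`. -/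
theorem eq_of_mem_frontier_of_inter_ball_eq {X : Type*} [MetricSpace X] {Ω : Set X}
    (hΩ : IsOpen Ω) {p q : X → ℝ} (hp : Continuous p) (hq : Continuous q) {x₀ : X} {r : ℝ}
    (h : Ω ∩ Metric.ball x₀ r = {x | p x < q x} ∩ Metric.ball x₀ r) {x : X}
    (hx : x ∈ frontier Ω) (hxr : x ∈ Metric.ball x₀ r) : p x = q x := by
  rw [hΩ.frontier_eq] at hx
  refine le_antisymm ?_ (not_lt.1 fun hlt => hx.2 ((h.symm.subset ⟨hlt, hxr⟩).1))
  have h1 : x ∈ closure (Ω ∩ Metric.ball x₀ r) := by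
    rw [inter_comm]
    exact Metric.isOpen_ball.inter_closure ⟨hxr, hx.1⟩
  have h2 : Ω ∩ Metric.ball x₀ r ⊆ {x | p x ≤ q x} := by
    rw [h]
    intro y hy
    have hlt : p y < q y := hy.1
    exact hlt.le
  exact closure_minimal h2 (isClosed_le hp hq) h1

/-- Near a boundary point of a Lipschitz domain, the surface measure times the length along a
direction that points into the domain is dominated by the volume measure. -/
theorem IsBoundedLipschitzDomain.exists_lintegral_boundary_layer_le
    (hΩ : IsBoundedLipschitzDomain Ω) {x₀ : Euc (d + 1)} (hx₀ : x₀ ∈ frontier Ω) :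
    ∃ (ν : Euc (d + 1)) (δ : ℝ) (C : ENNReal), 0 < δ ∧ C ≠ ⊤ ∧ ‖ν‖ₑ = 1 ∧
      ∀ h : Euc (d + 1) → ENNReal, Measurable h →
        ∫⁻ x in Metric.ball x₀ δ, ∫⁻ s in Ioo 0 δ, h (x + s • ν) ∂volume ∂(surf (frontier Ω)) ≤
          C * ∫⁻ x in Ω, h x := by
  obtain ⟨e, γ, K, r, hγ, hr, hloc⟩ := hΩ.lipschitz_boundary x₀ hx₀
  -- `Ψ` is the inverse of the chart, `Φ` parametrises the boundary by the graph of `γ`, and `ν` is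
  -- the vertical direction.
  let Ψ : Euc d × ℝ → Euc (d + 1) := fun p => e.symm (WithLp.toLp 2 p)
  have hΨ : MeasurePreserving Ψ :=
    e.symm.measurePreserving.comp (WithLp.volume_preserving_toLp (Euc d) ℝ)
  let Φ : Euc d → Euc (d + 1) := fun y => Ψ (y, γ y)
  let ν : Euc (d + 1) := Ψ (0, 1)
  have hν : ‖ν‖ = 1 := by
    simp only [ν, Ψ, LinearIsometryEquiv.norm_map]
    rw [WithLp.prod_norm_eq_of_L2]
    simp
  have hΨadd : ∀ y (a s : ℝ), Ψ (y, a) + s • ν = Ψ (y, a + s) := by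
    intro y a s
    simp only [Ψ, ν, ← map_smul, ← map_add, ← WithLp.toLp_smul, ← WithLp.toLp_add]
    simp
  obtain ⟨L, hL⟩ : ∃ L, LipschitzWith L Φ :=
    ⟨_, e.symm.lipschitz.comp ((WithLp.prod_lipschitzWith_toLp 2 (Euc d) ℝ).comp
      (LipschitzWith.id.prodMk hγ))⟩
  -- With half the radius, a vertical segment of length `δ` from a point of the smaller ball stays in
  -- the ball where the chart is valid.
  set δ := r / 2 with hδ
  have hδ0 : 0 < δ := half_pos hr
  set Γ := frontier Ω ∩ Metric.ball x₀ δ with hΓ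
  have hΓm : MeasurableSet Γ := isClosed_frontier.measurableSet.inter measurableSet_ball
  have hc1 : Continuous fun x => γ (e x).fst :=
    hγ.continuous.comp ((WithLp.prod_continuous_ofLp 2 (Euc d) ℝ).comp e.continuous).fst
  have hc2 : Continuous fun x => (e x).snd :=
    ((WithLp.prod_continuous_ofLp 2 (Euc d) ℝ).comp e.continuous).snd
  have hΓr : ∀ x ∈ Γ, x ∈ Metric.ball x₀ r := fun x hx =>
    Metric.ball_subset_ball (by linarith) hx.2
  have hgraph : ∀ x ∈ Γ, γ (e x).fst = (e x).snd := fun x hx =>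
    eq_of_mem_frontier_of_inter_ball_eq hΩ.isOpen hc1 hc2 hloc hx.1 (hΓr x hx)
  have hΦe : ∀ x ∈ Γ, Φ (e x).fst = x := by
    intro x hx
    simp only [Φ, Ψ, hgraph x hx]
    exact e.symm_apply_apply x
  have hinside : ∀ y, Φ y ∈ Γ → ∀ s ∈ Ioo 0 δ, Ψ (y, γ y + s) ∈ Ω := by
    intro y hy s hs
    refine (hloc.symm.subset ⟨?_, ?_⟩).1
    · simp [Ψ, hs.1]
    · rw [← hΨadd, Metric.mem_ball, dist_eq_norm]
      have h1 : ‖Ψ (y, γ y) - x₀‖ < δ := by simpa [dist_eq_norm] using hy.2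
      have h2 : ‖s • ν‖ < δ := by
        rw [norm_smul, hν, mul_one, Real.norm_of_nonneg hs.1.le]; exact hs.2
      rw [show Ψ (y, γ y) + s • ν - x₀ = (Ψ (y, γ y) - x₀) + s • ν by abel]
      linarith [norm_add_le (Ψ (y, γ y) - x₀) (s • ν)]
  have hΦm : Measurable Φ := hL.continuous.measurable
  have hmeas : (surf (frontier Ω)).restrict (Metric.ball x₀ δ) ≤
      (L : ENNReal) ^ d • Measure.map Φ (volume.restrict (Φ ⁻¹' Γ)) := by
    rw [surf, Measure.restrict_restrict measurableSet_ball, inter_comm, ← hΓ, Measure.le_iff]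
    intro B hB
    rw [Measure.restrict_apply hB, Measure.smul_apply, Measure.map_apply hΦm hB,
      Measure.restrict_apply (hΦm hB), ← EuclideanSpace.euclideanHausdorffMeasure_eq_volume,
      smul_eq_mul]
    refine le_trans (measure_mono ?_) (hL.euclideanHausdorffMeasure_image_le d _)
    intro x hx
    exact ⟨(e x).fst, by simp [hΦe x hx.2, hx.1, hx.2], hΦe x hx.2⟩
  refine ⟨ν, δ, (L : ENNReal) ^ d, hδ0, by simp, by rw [← enorm_norm, hν]; simp, fun h hh => ?_⟩
  have hΩm : MeasurableSet Ω := hΩ.isOpen.measurableSet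
  have hH : Measurable fun x => ∫⁻ s in Ioo 0 δ, h (x + s • ν) :=
    Measurable.lintegral_prod_right' (f := fun p : Euc (d + 1) × ℝ => h (p.1 + p.2 • ν))
      (hh.comp (by fun_prop))
  calc _ ≤ ∫⁻ x, (∫⁻ s in Ioo 0 δ, h (x + s • ν))
        ∂((L : ENNReal) ^ d • Measure.map Φ (volume.restrict (Φ ⁻¹' Γ))) :=
        lintegral_mono' hmeas le_rfl
    _ = (L : ENNReal) ^ d * ∫⁻ y in Φ ⁻¹' Γ, ∫⁻ s in Ioo 0 δ, h (Φ y + s • ν) := by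
        rw [lintegral_smul_measure, lintegral_map hH hΦm, smul_eq_mul]
    _ ≤ (L : ENNReal) ^ d * ∫⁻ y, ∫⁻ s, Ω.indicator h (Ψ (y, γ y + s)) := by
        gcongr (L : ENNReal) ^ d * ?_
        rw [← lintegral_indicator (hΦm hΓm)]
        refine lintegral_mono fun y => ?_
        by_cases hy : y ∈ Φ ⁻¹' Γ
        · rw [indicator_of_mem hy, ← lintegral_indicator measurableSet_Ioo]
          refine lintegral_mono fun s => ?_
          by_cases hs : s ∈ Ioo 0 δ
          · rw [indicator_of_mem hs, indicator_of_mem (hinside y hy s hs), ← hΨadd]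
          · simp [indicator_of_notMem hs]
        · simp [indicator_of_notMem hy]
    _ = (L : ENNReal) ^ d * ∫⁻ y, ∫⁻ τ, Ω.indicator h (Ψ (y, τ)) := by
        congr 1
        refine lintegral_congr fun y => ?_
        exact lintegral_add_left_eq_self (fun τ => Ω.indicator h (Ψ (y, τ))) (γ y)
    _ = (L : ENNReal) ^ d * ∫⁻ x in Ω, h x := by
        have hm : Measurable (Ω.indicator h) := hh.indicator hΩm
        rw [← lintegral_indicator hΩm, ← hΨ.lintegral_comp hm, Measure.volume_eq_prod,
          lintegral_prod (fun p => Ω.indicator h (Ψ p)) (hm.comp hΨ.measurable).aemeasurable]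

/-- Local trace theorem for constants: smooth functions that tend to a constant in `W^{1,1}(Ω)` tend
to the same constant in `L¹` on the boundary, near every boundary point. -/
theorem IsBoundedLipschitzDomain.tendsto_lintegral_boundary_sub_const
    (hΩ : IsBoundedLipschitzDomain Ω) {x₀ : Euc (d + 1)} (hx₀ : x₀ ∈ frontier Ω) :
    ∃ δ > 0, ∀ (c : ℝ) (φ : ℕ → Euc (d + 1) → ℝ), (∀ k, ContDiff ℝ ∞ (φ k)) →
      Tendsto (fun k => ∫⁻ x in Ω, ‖φ k x - c‖ₑ) atTop (𝓝 0) →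
      Tendsto (fun k => ∫⁻ x in Ω, ‖gradient (φ k) x‖ₑ) atTop (𝓝 0) →
      Tendsto (fun k => ∫⁻ x in Metric.ball x₀ δ, ‖φ k x - c‖ₑ ∂(surf (frontier Ω))) atTop
        (𝓝 0) := by
  obtain ⟨ν, δ, C, hδ, hC, hν, hlayer⟩ := hΩ.exists_lintegral_boundary_layer_le hx₀
  refine ⟨δ, hδ, fun c φ hφ ha hb => ?_⟩
  set D := ENNReal.ofReal δ with hD
  have hD0 : D ≠ 0 := by simpa [hD] using hδ
  have hDt : D ≠ ⊤ := ENNReal.ofReal_ne_top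
  have hle : ∀ k, D * ∫⁻ x in Metric.ball x₀ δ, ‖φ k x - c‖ₑ ∂(surf (frontier Ω)) ≤
      (C * ∫⁻ x in Ω, ‖φ k x - c‖ₑ) + D * (C * ∫⁻ x in Ω, ‖gradient (φ k) x‖ₑ) := by
    intro k
    have m1 : Measurable fun x => ‖φ k x - c‖ₑ :=
      ((hφ k).continuous.measurable.sub_const c).enorm
    have m2 : Measurable fun x => ‖gradient (φ k) x‖ₑ := (hφ k).continuous_gradient.measurable.enorm
    have mm : ∀ {h : Euc (d + 1) → ENNReal}, Measurable h →
        Measurable fun x => ∫⁻ s in Ioo 0 δ, h (x + s • ν) := fun {h} hh =>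
      Measurable.lintegral_prod_right' (f := fun p : Euc (d + 1) × ℝ => h (p.1 + p.2 • ν))
        (hh.comp (by fun_prop))
    -- Average `|φ(x) - c| ≤ |φ(x + s ν) - c| + ∫₀ˢ |∇φ(x + t ν)| dt` over `0 < s < δ`.
    have hpt : ∀ x, D * ‖φ k x - c‖ₑ ≤ (∫⁻ s in Ioo 0 δ, ‖φ k (x + s • ν) - c‖ₑ) +
        D * ∫⁻ t in Ioo 0 δ, ‖gradient (φ k) (x + t • ν)‖ₑ := by
      intro x
      have hvol : volume (Ioo 0 δ) = D := by simp [hD]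
      have e1 : D * ‖φ k x - c‖ₑ = ∫⁻ _ in Ioo 0 δ, ‖φ k x - c‖ₑ := by
        rw [setLIntegral_const, hvol, mul_comm]
      have e2 : D * ∫⁻ t in Ioo 0 δ, ‖gradient (φ k) (x + t • ν)‖ₑ =
          ∫⁻ _ in Ioo 0 δ, ∫⁻ t in Ioo 0 δ, ‖gradient (φ k) (x + t • ν)‖ₑ := by
        rw [setLIntegral_const, hvol, mul_comm]
      rw [e1, e2, ← lintegral_add_right _ measurable_const]
      refine setLIntegral_mono' measurableSet_Ioo fun s hs => ?_
      have h1 := enorm_sub_le_lintegral_gradient (hφ k) x ν hs.1.le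
      rw [hν, one_mul, ← restrict_Ioo_eq_restrict_Icc] at h1
      have h2 : ∫⁻ t in Ioo 0 s, ‖gradient (φ k) (x + t • ν)‖ₑ ≤
          ∫⁻ t in Ioo 0 δ, ‖gradient (φ k) (x + t • ν)‖ₑ :=
        lintegral_mono_set (Ioo_subset_Ioo_right hs.2.le)
      rw [show φ k x - c = (φ k (x + s • ν) - c) - (φ k (x + s • ν) - φ k x) by ring]
      refine (enorm_sub_le).trans ?_
      gcongr
      exact h1.trans h2
    calc _ = ∫⁻ x in Metric.ball x₀ δ, D * ‖φ k x - c‖ₑ ∂(surf (frontier Ω)) :=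
          (lintegral_const_mul' _ _ hDt).symm
      _ ≤ ∫⁻ x in Metric.ball x₀ δ, ((∫⁻ s in Ioo 0 δ, ‖φ k (x + s • ν) - c‖ₑ) +
            D * ∫⁻ t in Ioo 0 δ, ‖gradient (φ k) (x + t • ν)‖ₑ) ∂(surf (frontier Ω)) :=
          lintegral_mono hpt
      _ ≤ _ := by
          rw [lintegral_add_left (mm m1), lintegral_const_mul' _ _ hDt]
          gcongr
          · exact hlayer _ m1
          · exact hlayer _ m2
  have hlim := (ENNReal.Tendsto.const_mul (a := C) ha (Or.inr hC)).add
    (ENNReal.Tendsto.const_mul (a := D) (ENNReal.Tendsto.const_mul (a := C) hb (Or.inr hC))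
      (Or.inr hDt))
  simp only [mul_zero, add_zero] at hlim
  have h0 := tendsto_of_tendsto_of_tendsto_of_le_of_le tendsto_const_nhds hlim (fun _ => zero_le)
    hle
  have h1 := ENNReal.Tendsto.const_mul (a := D⁻¹) h0 (Or.inr (ENNReal.inv_ne_top.2 hD0))
  simpa only [mul_zero, ← mul_assoc, ENNReal.inv_mul_cancel hD0 hDt, one_mul] using h1

theorem tendsto_lintegral_enorm_of_tendsto_eLpNorm_two {X E : Type*} [MeasurableSpace X]
    [NormedAddCommGroup E] {μ : Measure X} [IsFiniteMeasure μ] {F : ℕ → X → E}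
    (hF : ∀ k, AEStronglyMeasurable (F k) μ)
    (h : Tendsto (fun k => eLpNorm (F k) 2 μ) atTop (𝓝 0)) :
    Tendsto (fun k => ∫⁻ x, ‖F k x‖ₑ ∂μ) atTop (𝓝 0) := by
  have h1 := ENNReal.Tendsto.mul_const (b := μ univ ^ (1 / (1 : ENNReal).toReal -
    1 / (2 : ENNReal).toReal)) h (Or.inr (ENNReal.rpow_ne_top_of_nonneg (by norm_num) (by simp)))
  rw [zero_mul] at h1
  refine tendsto_of_tendsto_of_tendsto_of_le_of_le tendsto_const_nhds h1 (fun _ => zero_le)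
    fun k => ?_
  rw [← eLpNorm_one_eq_lintegral_enorm]
  exact eLpNorm_le_eLpNorm_mul_rpow_measure_univ (by norm_num) (hF k)

/-- On a bounded Lipschitz domain, a function with vanishing weak gradient whose trace vanishes on a
part of the boundary of positive surface measure is zero. -/
theorem IsBoundedLipschitzDomain.ae_eq_zero_of_grad_eq_zero (hΩ : IsBoundedLipschitzDomain Ω)
    {z : H1 Ω} {f : Euc (d + 1) → ℝ} (hz : HasTrace z f) (hgrad : z.grad =ᵐ[volume.restrict Ω] 0)
    {Γ₁ : Set (Euc (d + 1))} (hsub : Γ₁ ⊆ frontier Ω)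
    (hpos : 0 < surf Γ₁ univ) (hf0 : f =ᵐ[surf Γ₁] 0) :
    z.toFun =ᵐ[volume.restrict Ω] 0 := by
  obtain ⟨hf, φ, hφ, h1, h2, h3⟩ := hz
  have hΩm : MeasurableSet Ω := hΩ.isOpen.measurableSet
  have : IsFiniteMeasure (volume.restrict Ω) := ⟨by simpa using hΩ.isBounded.measure_lt_top⟩
  have ha₀ := tendsto_lintegral_enorm_of_tendsto_eLpNorm_two
    (fun k => (hφ k).continuous.aestronglyMeasurable.sub z.memLp_toFun.1) h1
  have hb₀ := tendsto_lintegral_enorm_of_tendsto_eLpNorm_two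
    (fun k => (hφ k).continuous_gradient.aestronglyMeasurable.sub z.memLp_grad.1) h2
  -- The translation argument needs a function that is measurable on the whole space.
  obtain ⟨u, hum, hu⟩ := z.memLp_toFun.1.aemeasurable
  have ha : Tendsto (fun k => ∫⁻ x in Ω, ‖φ k x - u x‖ₑ) atTop (𝓝 0) := by
    refine ha₀.congr fun k => lintegral_congr_ae ?_
    filter_upwards [hu] with x hx
    simp [hx]
  have hb : Tendsto (fun k => ∫⁻ x in Ω, ‖gradient (φ k) x‖ₑ) atTop (𝓝 0) := by
    refine hb₀.congr fun k => lintegral_congr_ae ?_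
    filter_upwards [hgrad] with x hx
    simp [hx]
  obtain ⟨c, hc⟩ : ∃ c, ∀ᵐ x ∂(volume.restrict Ω), u x = c := by
    refine exists_ae_eq_const_of_locally hΩm hΩ.isConnected fun x hx => ?_
    obtain ⟨r, hr, hball⟩ := Metric.isOpen_iff.1 hΩ.isOpen x hx
    exact ⟨r / 3, by positivity, exists_ae_eq_const_ball_of_tendsto_gradient hum hφ ha hb hΩm
      (by positivity) (by rwa [mul_div_cancel₀ _ (by norm_num)])⟩
  suffices c = 0 by
    filter_upwards [hu, hc] with x hx hx'
    simp [hx, hx', this]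
  have hac : Tendsto (fun k => ∫⁻ x in Ω, ‖φ k x - c‖ₑ) atTop (𝓝 0) := by
    refine ha.congr fun k => lintegral_congr_ae ?_
    filter_upwards [hc] with x hx
    simp [hx]
  by_contra hne
  refine hpos.ne' ?_
  rw [surf, Measure.restrict_apply_univ]
  refine measure_null_of_locally_null _ fun x₀ hx₀ => ?_
  obtain ⟨δ, hδ, hlim⟩ := hΩ.tendsto_lintegral_boundary_sub_const (hsub hx₀)
  refine ⟨Γ₁ ∩ Metric.ball x₀ δ, inter_mem_nhdsWithin _ (Metric.ball_mem_nhds x₀ hδ), ?_⟩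
  set μ := (surf (frontier Ω)).restrict (Metric.ball x₀ δ) with hμ
  have t1 : TendstoInMeasure μ φ atTop (fun _ => c) := by
    refine tendstoInMeasure_of_tendsto_eLpNorm one_ne_zero
      (fun k => (hφ k).continuous.aestronglyMeasurable) aestronglyMeasurable_const ?_
    simpa only [eLpNorm_one_eq_lintegral_enorm, Pi.sub_apply] using hlim c φ hφ hac hb
  have t2 : TendstoInMeasure μ φ atTop f := by
    refine tendstoInMeasure_of_tendsto_eLpNorm two_ne_zero
      (fun k => (hφ k).continuous.aestronglyMeasurable) hf.1.restrict ?_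
    exact tendsto_of_tendsto_of_tendsto_of_le_of_le tendsto_const_nhds h3 (fun _ => zero_le)
      fun k => eLpNorm_mono_measure _ Measure.restrict_le_self
  have hfc := tendstoInMeasure_ae_unique t1 t2
  have hfc' : ∀ᵐ x ∂((surf Γ₁).restrict (Metric.ball x₀ δ)), c = f x := by
    refine ae_mono (Measure.restrict_mono le_rfl ?_) hfc
    exact Measure.restrict_mono hsub le_rfl
  have hff : ∀ᵐ x ∂((surf Γ₁).restrict (Metric.ball x₀ δ)), False := by
    filter_upwards [hfc', ae_restrict_of_ae hf0] with x hx hx'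
    exact hne (hx.trans hx')
  rw [eventually_false_iff_eq_bot, ae_eq_bot, surf, Measure.restrict_restrict measurableSet_ball,
    Measure.restrict_eq_zero, inter_comm] at hff
  exact hff

end Boundary

/-! ### Comparison of solutions -/

section Comparison

theorem Real.smoothTransition.exists_abs_deriv_le : ∃ C, ∀ t, |deriv smoothTransition t| ≤ C := by
  have hc : Continuous (deriv smoothTransition) :=
    (Real.smoothTransition.contDiff (n := 1)).continuous_deriv (by simp)
  obtain ⟨C, hC⟩ := (isCompact_Icc (a := (0 : ℝ)) (b := 1)).exists_bound_of_continuousOn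
    hc.continuousOn
  have hC0 : 0 ≤ C := (norm_nonneg _).trans (hC 0 (by simp))
  refine ⟨C, fun t => ?_⟩
  rcases lt_or_ge t 0 with h | h
  · have : smoothTransition =ᶠ[𝓝 t] fun _ => 0 := by
      filter_upwards [Iio_mem_nhds h] with s hs using zero_of_nonpos (le_of_lt hs)
    simpa [this.deriv_eq] using hC0
  · rcases lt_or_ge 1 t with h' | h'
    · have : smoothTransition =ᶠ[𝓝 t] fun _ => 1 := by
        filter_upwards [Ioi_mem_nhds h'] with s hs using one_of_one_le (le_of_lt hs)
      simpa [this.deriv_eq] using hC0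
    · exact hC t ⟨h, h'⟩

variable {d : ℕ} {Ω Γ₁ Γ₂ : Set (Euc (d + 1))}

theorem dirichletForm_sub_left (u₁ u₂ v : H1 Ω) :
    dirichletForm (u₁.sub u₂) v = dirichletForm u₁ v - dirichletForm u₂ v := by
  have hi : ∀ u : H1 Ω, Integrable (fun x => inner ℝ (u.grad x) (v.grad x))
      (volume.restrict Ω) := fun u => by
    have := (v.memLp_grad.norm.mul (r := 1) u.memLp_grad.norm)
    refine (memLp_one_iff_integrable.1 this).mono'
      (u.memLp_grad.1.inner v.memLp_grad.1) (Eventually.of_forall fun x => ?_)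
    exact norm_inner_le_norm _ _
  simp only [dirichletForm, H1.sub, Pi.sub_apply, inner_sub_left]
  exact integral_sub (hi u₁) (hi u₂)

/-- The test function of the comparison argument: a smooth substitute `z = η(u₁ - u₂)` for the
positive part of `u₁ - u₂`. Its energy against `u₁ - u₂` is nonnegative; if this energy and the
trace of `z` on `Γ₁` vanish, then `z = 0`, that is `u₁ ≤ u₂`. -/
theorem IsBoundedLipschitzDomain.exists_comparison_function (hΩ : IsBoundedLipschitzDomain Ω)
    (hsub : Γ₁ ⊆ frontier Ω) (hpos : 0 < surf Γ₁ univ) {u₁ u₂ : H1 Ω}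
    {t₁ t₂ : Euc (d + 1) → ℝ} (h₁ : HasTrace u₁ t₁) (h₂ : HasTrace u₂ t₂) :
    ∃ z : H1 Ω, (z.toFun = fun x => Real.smoothTransition (u₁.toFun x - u₂.toFun x)) ∧
      HasTrace z (fun x => Real.smoothTransition (t₁ x - t₂ x)) ∧
      dirichletForm u₂ z ≤ dirichletForm u₁ z ∧
      (dirichletForm u₁ z ≤ dirichletForm u₂ z →
        (∀ᵐ x ∂(surf Γ₁), Real.smoothTransition (t₁ x - t₂ x) = 0) →
        ∀ᵐ x ∂(volume.restrict Ω), u₁.toFun x ≤ u₂.toFun x) := by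
  obtain ⟨C, hC⟩ := Real.smoothTransition.exists_abs_deriv_le
  obtain ⟨z, hz, hzg, hzt⟩ := (h₁.sub h₂).exists_comp hΩ.isBounded
    (Real.smoothTransition.contDiff (n := ⊤)) Real.smoothTransition.zero hC
  have hd : ∀ t, 0 ≤ deriv Real.smoothTransition t := fun t =>
    Real.smoothTransition.monotone.deriv_nonneg
  set w := u₁.sub u₂
  have hform : dirichletForm w z =
      ∫ x in Ω, deriv Real.smoothTransition (w.toFun x) * ‖w.grad x‖ ^ 2 := by
    simp only [dirichletForm, hzg, inner_smul_right, real_inner_self_eq_norm_sq]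
  have hnn : ∀ x, 0 ≤ deriv Real.smoothTransition (w.toFun x) * ‖w.grad x‖ ^ 2 := fun x =>
    mul_nonneg (hd _) (sq_nonneg _)
  refine ⟨z, hz, hzt, ?_, fun hle h0 => ?_⟩
  · rw [← sub_nonneg, ← dirichletForm_sub_left, hform]
    exact integral_nonneg hnn
  · rw [← sub_nonpos, ← dirichletForm_sub_left, hform] at hle
    have hint : Integrable (fun x => deriv Real.smoothTransition (w.toFun x) * ‖w.grad x‖ ^ 2)
        (volume.restrict Ω) := by
      refine Integrable.bdd_mul (c := C) w.memLp_grad.norm.integrable_sq ?_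
        (Eventually.of_forall fun x => hC _)
      exact ((Real.smoothTransition.contDiff (n := 1)).continuous_deriv
        (by simp)).comp_aestronglyMeasurable w.memLp_toFun.1
    have hzero := (integral_eq_zero_iff_of_nonneg hnn hint).1
      (le_antisymm hle (integral_nonneg hnn))
    have hgrad : z.grad =ᵐ[volume.restrict Ω] 0 := by
      filter_upwards [hzero] with x hx
      rw [hzg]
      rcases mul_eq_zero.1 hx with h | h
      · simp [h]
      · have : w.grad x = 0 := by simpa using h
        simp [this]
    filter_upwards [hΩ.ae_eq_zero_of_grad_eq_zero hzt hgrad hsub hpos h0] with x hx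
    rw [hz] at hx
    exact sub_nonpos.1 (Real.smoothTransition.zero_iff_nonpos.1 hx)

theorem integral_mul_le_integral_mul_of_le {X : Type*} [MeasurableSpace X] {μ : Measure X}
    {f₁ f₂ v : X → ℝ} (h₁ : MemLp f₁ 2 μ) (h₂ : MemLp f₂ 2 μ) (hv : MemLp v 2 μ)
    (hle : ∀ᵐ x ∂μ, f₁ x ≤ f₂ x) (hv0 : ∀ x, 0 ≤ v x) :
    ∫ x, f₁ x * v x ∂μ ≤ ∫ x, f₂ x * v x ∂μ := by
  refine integral_mono_ae (h₁.integrable_mul hv) (h₂.integrable_mul hv) ?_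
  filter_upwards [hle] with x hx
  exact mul_le_mul_of_nonneg_right hx (hv0 x)

theorem HasTrace.memLp_surf {u : H1 Ω} {f : Euc (d + 1) → ℝ} (h : HasTrace u f)
    {Γ : Set (Euc (d + 1))} (hsub : Γ ⊆ frontier Ω) : MemLp f 2 (surf Γ) :=
  h.1.mono_measure (Measure.restrict_mono hsub le_rfl)

end Comparison

/-- Monotonicity of the solutions of the elliptic mixed problems `P` and `P_α` with respect to the
data. -/
theorem mainTheorem12 {d : ℕ} (Ω Γ₁ Γ₂ : Set (Euc (d + 1)))
    (hΩ : IsBoundedLipschitzDomain Ω)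
    (hΓ₁ : MeasurableSet Γ₁) (hΓ₂ : MeasurableSet Γ₂)
    (hΓ : Γ₁ ∪ Γ₂ = frontier Ω) (hdisj : Disjoint Γ₁ Γ₂)
    (hpos₁ : 0 < surf Γ₁ univ) (hpos₂ : 0 < surf Γ₂ univ)
    (q₀ : Euc (d + 1) → ℝ) (hq₀ : MemLp q₀ 2 (surf Γ₂)) (hq₀pos : ∀ᵐ x ∂(surf Γ₂), 0 < q₀ x)
    (l₁ l₂ : ℝ) (hl : l₂ ≤ l₁)
    (g₁ g₂ : Euc (d + 1) → ℝ)
    (hg₁ : MemLp g₁ 2 (volume.restrict Ω)) (hg₂ : MemLp g₂ 2 (volume.restrict Ω))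
    (hg : ∀ᵐ x ∂(volume.restrict Ω), g₁ x ≤ g₂ x) :
    (∀ b : Euc (d + 1) → ℝ, MemHHalf Ω Γ₁ b →
      ∀ u₁ u₂ : H1 Ω, IsSolutionP Γ₁ Γ₂ b (l₁ • q₀) g₁ u₁ →
        IsSolutionP Γ₁ Γ₂ b (l₂ • q₀) g₂ u₂ →
        ∀ᵐ x ∂(volume.restrict Ω), u₁.toFun x ≤ u₂.toFun x) ∧
    (∀ α : ℝ, 0 < α → ∀ b₁ b₂ : Euc (d + 1) → ℝ, MemHHalf Ω Γ₁ b₁ → MemHHalf Ω Γ₁ b₂ →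
      (∀ᵐ x ∂(surf Γ₁), b₁ x ≤ b₂ x) →
      ∀ u₁ u₂ : H1 Ω, IsSolutionPα Γ₁ Γ₂ α b₁ (l₁ • q₀) g₁ u₁ →
        IsSolutionPα Γ₁ Γ₂ α b₂ (l₂ • q₀) g₂ u₂ →
        ∀ᵐ x ∂(volume.restrict Ω), u₁.toFun x ≤ u₂.toFun x) := by
  have hs₁ : Γ₁ ⊆ frontier Ω := hΓ ▸ subset_union_left
  have hs₂ : Γ₂ ⊆ frontier Ω := hΓ ▸ subset_union_right
  -- The right-hand sides of the two equations are ordered on nonnegative test functions.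
  have hdata : ∀ (z : H1 Ω) (tz : Euc (d + 1) → ℝ), HasTrace z tz → (∀ x, 0 ≤ z.toFun x) →
      (∀ x, 0 ≤ tz x) →
      (∫ x in Ω, g₁ x * z.toFun x) - ∫ x, (l₁ • q₀) x * tz x ∂(surf Γ₂) ≤
        (∫ x in Ω, g₂ x * z.toFun x) - ∫ x, (l₂ • q₀) x * tz x ∂(surf Γ₂) := by
    intro z tz hz hz0 htz0
    refine sub_le_sub (integral_mul_le_integral_mul_of_le hg₁ hg₂ z.memLp_toFun hg hz0)
      (integral_mul_le_integral_mul_of_le (hq₀.const_smul l₂) (hq₀.const_smul l₁)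
        (hz.memLp_surf hs₂) ?_ htz0)
    filter_upwards [hq₀pos] with x hx
    exact mul_le_mul_of_nonneg_right hl hx.le
  refine ⟨?_, ?_⟩
  · rintro b - u₁ u₂ ⟨⟨t₁, h₁, hb₁⟩, hsol₁⟩ ⟨⟨t₂, h₂, hb₂⟩, hsol₂⟩
    obtain ⟨z, hz, hzt, -, hcomp⟩ := hΩ.exists_comparison_function hs₁ hpos₁ h₁ h₂
    have h0 : ∀ᵐ x ∂(surf Γ₁), Real.smoothTransition (t₁ x - t₂ x) = 0 := by
      filter_upwards [hb₁, hb₂] with x hx₁ hx₂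
      simp [hx₁, hx₂]
    refine hcomp ?_ h0
    rw [hsol₁ z _ hzt h0, hsol₂ z _ hzt h0]
    exact hdata z _ hzt (fun x => hz ▸ Real.smoothTransition.nonneg _)
      fun x => Real.smoothTransition.nonneg _
  · rintro α hα b₁ b₂ ⟨v₁, f₁, hv₁, hf₁⟩ ⟨v₂, f₂, hv₂, hf₂⟩ hb u₁ u₂ ⟨t₁, h₁, hsol₁⟩ ⟨t₂, h₂, hsol₂⟩
    obtain ⟨z, hz, hzt, hform, hcomp⟩ := hΩ.exists_comparison_function hs₁ hpos₁ h₁ h₂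
    have e₁ := hsol₁ z _ hzt
    have e₂ := hsol₂ z _ hzt
    have hd := hdata z _ hzt (fun x => hz ▸ Real.smoothTransition.nonneg _)
      fun x => Real.smoothTransition.nonneg _
    set tz : Euc (d + 1) → ℝ := fun x => Real.smoothTransition (t₁ x - t₂ x) with htz
    have hbz := integral_mul_le_integral_mul_of_le ((hv₁.memLp_surf hs₁).ae_eq hf₁)
      ((hv₂.memLp_surf hs₁).ae_eq hf₂) (hzt.memLp_surf hs₁) hb
      fun x => Real.smoothTransition.nonneg _
    have i₁ := (h₁.memLp_surf hs₁).integrable_mul (hzt.memLp_surf hs₁)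
    have i₂ := (h₂.memLp_surf hs₁).integrable_mul (hzt.memLp_surf hs₁)
    -- `t η(t) ≥ 0`, so the boundary term has a sign as well.
    have hnn : ∀ x, 0 ≤ t₁ x * tz x - t₂ x * tz x := by
      intro x
      rw [← sub_mul]
      rcases le_total (t₁ x - t₂ x) 0 with h | h
      · simp [htz, Real.smoothTransition.zero_of_nonpos h]
      · exact mul_nonneg h (Real.smoothTransition.nonneg _)
    have hI : ∫ x, (t₁ x * tz x - t₂ x * tz x) ∂(surf Γ₁) =
        ∫ x, t₁ x * tz x ∂(surf Γ₁) - ∫ x, t₂ x * tz x ∂(surf Γ₁) := integral_sub i₁ i₂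
    have hI0 : 0 ≤ ∫ x, (t₁ x * tz x - t₂ x * tz x) ∂(surf Γ₁) := integral_nonneg hnn
    have hαb := mul_le_mul_of_nonneg_left hbz hα.le
    have hαI := mul_nonneg hα.le hI0
    rw [hI, mul_sub] at hαI
    refine hcomp (by linarith) ?_
    have hαI' : α * ∫ x, (t₁ x * tz x - t₂ x * tz x) ∂(surf Γ₁) ≤ 0 := by
      rw [hI, mul_sub]
      linarith
    have hIz : ∫ x, (t₁ x * tz x - t₂ x * tz x) ∂(surf Γ₁) = 0 :=
      le_antisymm (nonpos_of_mul_nonpos_right hαI' hα) hI0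
    filter_upwards [(integral_eq_zero_iff_of_nonneg hnn (i₁.sub i₂)).1 hIz] with x hx
    have hx' : (t₁ x - t₂ x) * tz x = 0 := by rw [sub_mul]; exact hx
    rcases mul_eq_zero.1 hx' with h | h
    · simp [h]
    · exact h
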